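/- Let $X,Y$ be arbitrary topological spaces and $I,J$ arbitrary index sets. "For almost all $z$" means for comeagerly many $z$. Let $\mathrm{Cat}(X)$ be the Boolean algebra of subsets of $X$ with the Baire property modulo meager sets, with $0$ and $1$ its least and greatest elements, and for $a\in\mathrm{Cat}(X)$ put $\mathrm{Cat}(X){\restriction}a=\{c\in\mathrm{Cat}(X):c\le a\}$. Let $\mathrm{Baire}(X,\mathbb N^I)$ be the set of functions $f:X\to\mathbb N^I$ all of whose coordinates $z\mapsto f(z)(i)$ are Baire measurable (preimages of open sets have the Baire property). Write $f=_{aa}g$ (resp. $f\le_{aa}g$) if for every $i\in I$, $f(z)(i)=g(z)(i)$ (resp. $f(z)(i)\le g(z)(i)$) for almost all $z\in X$. Order $\mathrm{Baire}(X,\mathbb N^I)/{=_{aa}}$ by $\le_{aa}$; it is a lattice and, with $[f]+[g]=[f+g]$, a commutative monoid. For $a\in\mathrm{Cat}(X)$ and $i\in I$, let $\chi_i\in\mathbb N^I$ be the characteristic function of $\{i\}$ and let $\langle a,\chi_i\rangle$ be the class of the function equal to $\chi_i$ on a representative of $a$ and to $0$ elsewhere. Let $\|f(i)=n\|=[\{z:f(z)(i)=n\}]\in\mathrm{Cat}(X)$.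 An order embedding is a map that preserves and reflects the order; a map between posets is dually continuous if it is continuous for the Scott topologies and also for the Scott topologies of the dual posets; a subset $A$ of a poset is convex if $p\le r\le q$ and $p,q\in A$ imply $r\in A$. **Theorem.** (1) Let $\sigma:\mathrm{Baire}(X,\mathbb N^I)/{=_{aa}}\to\mathrm{Baire}(Y,\mathbb N^J)/{=_{aa}}$ be an order embedding with convex range. Then $\sigma$ is a dually continuous lattice homomorphism. If $I\neq\emptyset$, then $\sigma$ is determined by the values $\sigma(\langle a,\chi_i\rangle)$ ($a\in\mathrm{Cat}(X)$, $i\in I$): any order embedding with convex range having the same values there equals $\sigma$. Moreover there are $[h]\in\mathrm{Baire}(Y,\mathbb N^J)/{=_{aa}}$, elements $a^i_j\in\mathrm{Cat}(X)$ and $b^i_j\in\mathrm{Cat}(Y)$, and order isomorphisms $\tau^i_j:\mathrm{Cat}(X){\restriction}a^i_j\to\mathrm{Cat}(Y){\restriction}b^i_j$ (so $b^i_j=\tau^i_j(a^i_j)$) for $i\in I$, $j\in J$, such that (a) $a^i_j\wedge a^i_{j^*}=0$ whenever $j\ne j^*$, and $\bigvee_{j\in J}a^i_j=1$, for every $i\in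 I$; (b) $\tau^i_j(a^i_j)\wedge\tau^{i^*}_j(a^{i^*}_j)=0$ whenever $i\neq i^*$, for every $j\in J$; and a map $\sigma_0:\mathrm{Baire}(X,\mathbb N^I)/{=_{aa}}\to\mathrm{Baire}(Y,\mathbb N^J)/{=_{aa}}$ with, for all $f\in\mathrm{Baire}(X,\mathbb N^I)$, $a\in\mathrm{Cat}(X)$ and $i\in I$, (c) $\sigma([f])=\sigma_0([f])+[h]$; (d) $\sigma_0(\langle a,\chi_i\rangle)=\bigvee_{j\in J}\langle\tau^i_j(a\wedge a^i_j),\chi_j\rangle$; (e) $\sigma_0([f])=\bigvee_{i\in I}\bigvee_{n=0}^{\infty}n\cdot\sigma_0(\langle\|f(i)=n\|,\chi_i\rangle)$; where all the suprema exist. (2) Conversely, for any $[h]$, $a^i_j$, $b^i_j$ and isomorphisms $\tau^i_j$ ($i\in I$, $j\in J$) as above satisfying (a) and (b), there is exactly one map $\sigma$ given by (c), (d), (e) (for some $\sigma_0$, with all the suprema existing), and this $\sigma$ is an order embedding with convex range. -/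

import Mathlib

open Filter Topology

namespace BaireQuot

universe u v w

/-- A map between topological spaces is Baire measurable if preimages of open sets have the
Baire property. -/
def BaireMeasurable {X : Type u} {S : Type v} [TopologicalSpace X] [TopologicalSpace S]
    (g : X → S) : Prop :=
  ∀ U : Set S, IsOpen U → BaireMeasurableSet (g ⁻¹' U)

theorem baireMeasurable_nat_iff {X : Type u} [TopologicalSpace X] {g : X → ℕ} :
    BaireMeasurable g ↔ ∀ n, BaireMeasurableSet {z | g z = n} := by
  constructor
  · intro h n
    exact h {n} (isOpen_discrete _)
  · intro h U _
    have : g ⁻¹' U = ⋃ n : U, {z | g z = (n : ℕ)} := by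
      ext z; simp
    rw [this]
    exact BaireMeasurableSet.iUnion fun n => h n

theorem BaireMeasurable.map₂ {X : Type u} [TopologicalSpace X] {f g : X → ℕ}
    (hf : BaireMeasurable f) (hg : BaireMeasurable g) (op : ℕ → ℕ → ℕ) :
    BaireMeasurable fun z => op (f z) (g z) := by
  rw [baireMeasurable_nat_iff] at *
  intro n
  have : {z | op (f z) (g z) = n} =
      ⋃ p : {p : ℕ × ℕ // op p.1 p.2 = n}, ({z | f z = p.1.1} ∩ {z | g z = p.1.2}) := by
    ext z
    constructor
    · intro hz
      exact Set.mem_iUnion.2 ⟨⟨(f z, g z), hz⟩, rfl, rfl⟩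
    · intro hz
      obtain ⟨⟨p, hp⟩, h1, h2⟩ := Set.mem_iUnion.1 hz
      simp only [Set.mem_ofPred_eq] at h1 h2 ⊢
      rw [h1, h2, hp]
  rw [this]
  exact BaireMeasurableSet.iUnion fun p => (hf _).inter (hg _)

/-! ### The category algebra -/

/-- Subsets of `X` with the Baire property. -/
abbrev BP (X : Type u) [TopologicalSpace X] : Type u := {s : Set X // BaireMeasurableSet s}

/-- Equality of sets with the Baire property modulo the ideal of meager sets. -/
instance bpSetoid (X : Type u) [TopologicalSpace X] : Setoid (BP X) where
  r s t := ∀ᶠ z in residual X, z ∈ s.1 ↔ z ∈ t.1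
  iseqv :=
    { refl := fun _ => .of_forall fun _ => Iff.rfl
      symm := fun h => h.mono fun _ hz => hz.symm
      trans := fun h k => (h.and k).mono fun _ hz => hz.1.trans hz.2 }

/-- The category algebra of `X`: sets with the Baire property modulo meager sets. -/
def Cat (X : Type u) [TopologicalSpace X] : Type u := Quotient (bpSetoid X)

namespace Cat

variable {X : Type u} [TopologicalSpace X]

/-- The class of a set with the Baire property. -/
def mk (s : Set X) (hs : BaireMeasurableSet s) : Cat X := Quotient.mk (bpSetoid X) ⟨s, hs⟩

/-- `[A] ≤ [B]` iff `A \ B` is meager; the operations are induced by `∪`, `∩` and complement. -/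
instance : BooleanAlgebra (Cat X) where
  le := Quotient.lift₂ (fun s t : BP X => ∀ᶠ z in residual X, z ∈ s.1 → z ∈ t.1)
    (fun _ _ _ _ h k => propext
      ⟨fun H => by filter_upwards [h, k, H] with z h k H using fun hz => k.1 (H (h.2 hz)),
       fun H => by filter_upwards [h, k, H] with z h k H using fun hz => k.2 (H (h.1 hz))⟩)
  sup := Quotient.map₂ (fun s t : BP X => ⟨s.1 ∪ t.1, s.2.union t.2⟩) (fun _ _ h _ _ k => by
    filter_upwards [h, k] with z h k using or_congr h k)
  inf := Quotient.map₂ (fun s t : BP X => ⟨s.1 ∩ t.1, s.2.inter t.2⟩) (fun _ _ h _ _ k => by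
    filter_upwards [h, k] with z h k using and_congr h k)
  compl := Quotient.map (fun s : BP X => ⟨s.1ᶜ, s.2.compl⟩) (fun _ _ h => by
    filter_upwards [h] with z h using not_congr h)
  top := mk Set.univ isOpen_univ.baireMeasurableSet
  bot := mk ∅ isOpen_empty.baireMeasurableSet
  le_refl a := by
    induction a using Quotient.inductionOn
    exact .of_forall fun _ => id
  le_trans a b c := by
    induction a, b using Quotient.inductionOn₂
    induction c using Quotient.inductionOn
    intro h k
    filter_upwards [h, k] with z h k using k ∘ h
  le_antisymm a b := by
    induction a, b using Quotient.inductionOn₂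
    intro h k
    refine Quotient.sound ?_
    filter_upwards [h, k] with z h k using ⟨h, k⟩
  le_sup_left a b := by
    induction a, b using Quotient.inductionOn₂
    exact .of_forall fun _ => Or.inl
  le_sup_right a b := by
    induction a, b using Quotient.inductionOn₂
    exact .of_forall fun _ => Or.inr
  sup_le a b c := by
    induction a, b using Quotient.inductionOn₂
    induction c using Quotient.inductionOn
    intro h k
    filter_upwards [h, k] with z h k using Or.rec h k
  inf_le_left a b := by
    induction a, b using Quotient.inductionOn₂
    exact .of_forall fun _ => And.left
  inf_le_right a b := by
    induction a, b using Quotient.inductionOn₂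
    exact .of_forall fun _ => And.right
  le_inf a b c := by
    induction a, b using Quotient.inductionOn₂
    induction c using Quotient.inductionOn
    intro h k
    filter_upwards [h, k] with z h k using fun hz => ⟨h hz, k hz⟩
  le_sup_inf a b c := by
    induction a, b using Quotient.inductionOn₂
    induction c using Quotient.inductionOn
    exact .of_forall fun _ hz => by
      rcases hz with ⟨h | h, k | k⟩
      · exact Or.inl h
      · exact Or.inl h
      · exact Or.inl k
      · exact Or.inr ⟨h, k⟩
  inf_compl_le_bot a := by
    induction a using Quotient.inductionOn
    exact .of_forall fun _ hz => hz.2 hz.1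
  top_le_sup_compl a := by
    induction a using Quotient.inductionOn
    exact .of_forall fun z _ => Classical.em _
  le_top a := by
    induction a using Quotient.inductionOn
    exact .of_forall fun _ _ => trivial
  bot_le a := by
    induction a using Quotient.inductionOn
    exact .of_forall fun _ hz => hz.elim

end Cat

/-! ### Baire functions into `ℕ^I` modulo almost always equality -/

/-- Baire functions `X → ℕ^I`: each coordinate `z ↦ f z i` is Baire measurable. -/
abbrev BaireFun (X : Type u) [TopologicalSpace X] (I : Type w) : Type (max u w) :=
  {f : X → I → ℕ // ∀ i, BaireMeasurable fun z => f z i}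

/-- For countable `I`, coordinatewise Baire measurability is Baire measurability with respect to
the product topology of `ℕ^I`. -/
theorem baireMeasurable_pi_iff {X : Type u} [TopologicalSpace X] {I : Type w} [Countable I]
    (f : X → I → ℕ) : BaireMeasurable f ↔ ∀ i, BaireMeasurable fun z => f z i := by
  constructor
  · intro h i U hU
    exact h _ (hU.preimage (continuous_apply i))
  · intro h U hU
    let _ : MeasurableSpace X := eventuallyMeasurableSpace (borel X) (residual X)
    have hf : Measurable f := measurable_pi_iff.2 fun i => by
      refine measurable_to_countable' fun n => ?_
      exact h i {n} (isOpen_discrete _)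
    exact hf hU.measurableSet

/-- `f =_aa g`: for every `i`, `f z i = g z i` for comeagerly many `z`. -/
instance aaSetoid (X : Type u) [TopologicalSpace X] (I : Type w) : Setoid (BaireFun X I) where
  r f g := ∀ i, ∀ᶠ z in residual X, f.1 z i = g.1 z i
  iseqv :=
    { refl := fun _ _ => .of_forall fun _ => rfl
      symm := fun h i => (h i).mono fun _ hz => hz.symm
      trans := fun h k i => ((h i).and (k i)).mono fun _ hz => hz.1.trans hz.2 }

/-- The quotient `Baire(X, ℕ^I) / =_aa`. -/
def BaireAA (X : Type u) [TopologicalSpace X] (I : Type w) : Type (max u w) :=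
  Quotient (aaSetoid X I)

namespace BaireAA

variable {X : Type u} [TopologicalSpace X] {I : Type w}

/-- The class of a Baire function. -/
def mk (f : X → I → ℕ) (hf : ∀ i, BaireMeasurable fun z => f z i) : BaireAA X I :=
  Quotient.mk (aaSetoid X I) ⟨f, hf⟩

/-- `[f] ≤ [g]` iff for every `i`, `f z i ≤ g z i` for comeagerly many `z`. -/
instance : Lattice (BaireAA X I) where
  le := Quotient.lift₂ (fun f g : BaireFun X I => ∀ i, ∀ᶠ z in residual X, f.1 z i ≤ g.1 z i)
    (fun _ _ _ _ h k => propext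
      ⟨fun H i => by filter_upwards [h i, k i, H i] with z h k H using h ▸ k ▸ H,
       fun H i => by filter_upwards [h i, k i, H i] with z h k H using h.symm ▸ k.symm ▸ H⟩)
  sup := Quotient.map₂
    (fun f g : BaireFun X I => ⟨fun z i => max (f.1 z i) (g.1 z i),
      fun i => (f.2 i).map₂ (g.2 i) max⟩)
    (fun _ _ h _ _ k i => by filter_upwards [h i, k i] with z h k using congrArg₂ max h k)
  inf := Quotient.map₂
    (fun f g : BaireFun X I => ⟨fun z i => min (f.1 z i) (g.1 z i),
      fun i => (f.2 i).map₂ (g.2 i) min⟩)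
    (fun _ _ h _ _ k i => by filter_upwards [h i, k i] with z h k using congrArg₂ min h k)
  le_refl a := by
    induction a using Quotient.inductionOn
    exact fun i => .of_forall fun _ => le_rfl
  le_trans a b c := by
    induction a, b using Quotient.inductionOn₂
    induction c using Quotient.inductionOn
    intro h k i
    filter_upwards [h i, k i] with z h k using h.trans k
  le_antisymm a b := by
    induction a, b using Quotient.inductionOn₂
    intro h k
    refine Quotient.sound fun i => ?_
    filter_upwards [h i, k i] with z h k using le_antisymm h k
  le_sup_left a b := by
    induction a, b using Quotient.inductionOn₂
    exact fun i => .of_forall fun _ => le_max_left _ _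
  le_sup_right a b := by
    induction a, b using Quotient.inductionOn₂
    exact fun i => .of_forall fun _ => le_max_right _ _
  sup_le a b c := by
    induction a, b using Quotient.inductionOn₂
    induction c using Quotient.inductionOn
    intro h k i
    filter_upwards [h i, k i] with z h k using max_le h k
  inf_le_left a b := by
    induction a, b using Quotient.inductionOn₂
    exact fun i => .of_forall fun _ => min_le_left _ _
  inf_le_right a b := by
    induction a, b using Quotient.inductionOn₂
    exact fun i => .of_forall fun _ => min_le_right _ _
  le_inf a b c := by
    induction a, b using Quotient.inductionOn₂
    induction c using Quotient.inductionOn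
    intro h k i
    filter_upwards [h i, k i] with z h k using le_min h k

/-- Pointwise addition: `[f] + [g] = [f + g]`. -/
instance : Add (BaireAA X I) where
  add := Quotient.map₂
    (fun f g : BaireFun X I => ⟨fun z i => f.1 z i + g.1 z i,
      fun i => (f.2 i).map₂ (g.2 i) (· + ·)⟩)
    (fun _ _ h _ _ k i => by filter_upwards [h i, k i] with z h k using congrArg₂ (· + ·) h k)

/-- The class of the function constantly equal to `0`. -/
instance : Zero (BaireAA X I) where
  zero := mk (fun _ _ => 0) fun _ => baireMeasurable_nat_iff.2 fun n => by
    by_cases h : 0 = n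
    · simpa [h] using isOpen_univ.baireMeasurableSet
    · simpa [h] using isOpen_empty.baireMeasurableSet

instance : AddCommMonoid (BaireAA X I) where
  add_assoc a b c := by
    induction a, b using Quotient.inductionOn₂
    induction c using Quotient.inductionOn
    exact Quotient.sound fun i => .of_forall fun _ => add_assoc _ _ _
  add_comm a b := by
    induction a, b using Quotient.inductionOn₂
    exact Quotient.sound fun i => .of_forall fun _ => add_comm _ _
  zero_add a := by
    induction a using Quotient.inductionOn
    exact Quotient.sound fun i => .of_forall fun _ => zero_add _
  add_zero a := by
    induction a using Quotient.inductionOn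
    exact Quotient.sound fun i => .of_forall fun _ => add_zero _
  nsmul := nsmulRec

open scoped Classical in
/-- `⟨a, x⟩` is the class of the function with value `x` on a representative of `a` and `0`
elsewhere; it does not depend on the representative. -/
noncomputable def iprod (a : Cat X) (x : I → ℕ) : BaireAA X I :=
  Quotient.lift
    (fun s : BP X => mk (fun z => if z ∈ s.1 then x else 0) fun i =>
      baireMeasurable_nat_iff.2 fun n => by
        have : {z | (if z ∈ s.1 then x else 0) i = n} =
            (s.1 ∩ {_z | x i = n}) ∪ (s.1ᶜ ∩ {_z | 0 = n}) := by
          ext z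
          by_cases hz : z ∈ s.1 <;> simp [hz]
        rw [this]
        have hc : ∀ p : Prop, BaireMeasurableSet {_z : X | p} := fun p => by
          by_cases hp : p
          · simpa [hp] using isOpen_univ.baireMeasurableSet
          · simpa [hp] using isOpen_empty.baireMeasurableSet
        exact (s.2.inter (hc _)).union (s.2.compl.inter (hc _)))
    (fun s t h => Quotient.sound fun i => by
      filter_upwards [h] with z hz
      simp only [hz]) a

open scoped Classical in
/-- The characteristic function `χ_i ∈ ℕ^I` of the point `i`. -/
noncomputable def chi (i : I) : I → ℕ := Pi.single i 1

/-- The Boolean value `‖f(i) = n‖ = [{z | f z i = n}] ∈ Cat(X)`. -/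
def boolVal (x : BaireAA X I) (i : I) (n : ℕ) : Cat X :=
  Quotient.lift
    (fun f : BaireFun X I => Cat.mk {z | f.1 z i = n} (baireMeasurable_nat_iff.1 (f.2 i) n))
    (fun f g h => Quotient.sound <| by
      filter_upwards [h i] with z hz
      simp only [hz]) x

end BaireAA

/-! ### Dually continuous lattice homomorphisms -/

/-- Topologically continuous for the Scott topologies, and for the Scott topologies of the
dual posets. -/
def DuallyContinuous {P : Type u} {Q : Type v} [PartialOrder P] [PartialOrder Q]
    (σ : P → Q) : Prop :=
  (@Continuous P Q (Topology.scott P Set.univ) (Topology.scott Q Set.univ) σ) ∧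
  (@Continuous Pᵒᵈ Qᵒᵈ (Topology.scott Pᵒᵈ Set.univ) (Topology.scott Qᵒᵈ Set.univ)
    fun p => OrderDual.toDual (σ (OrderDual.ofDual p)))

/-- Preserves binary suprema and infima. -/
def IsLatticeHom {P : Type u} {Q : Type v} [Lattice P] [Lattice Q] (σ : P → Q) : Prop :=
  ∀ x y, σ (x ⊔ y) = σ x ⊔ σ y ∧ σ (x ⊓ y) = σ x ⊓ σ y

/-! ### The data describing an embedding -/

/-- For each `i ∈ I` a partition `(a i j)_j` of unity in `Cat(X)`, and isomorphisms `τ i j` from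
the down set of `a i j` in `Cat(X)` onto the down set of `b i j` in `Cat(Y)` (so that
`b i j = τ i j (a i j)`), where `b i j` and `b i' j` are disjoint for `i ≠ i'`. -/
structure EmbData (X : Type*) (Y : Type*) (I : Type*) (J : Type*)
    [TopologicalSpace X] [TopologicalSpace Y] where
  a : I → J → Cat X
  b : I → J → Cat Y
  τ : ∀ i j, Set.Iic (a i j) ≃o Set.Iic (b i j)
  disjoint_a : ∀ i j j', j ≠ j' → a i j ⊓ a i j' = ⊥
  sup_a : ∀ i, IsLUB (Set.range (a i)) ⊤
  disjoint_b : ∀ i i' j, i ≠ i' → b i j ⊓ b i' j = ⊥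

open BaireAA in
/-- `σ = σ₀ + h`, where `σ₀⟨c, χ_i⟩ = ⋁_j ⟨τ^i_j (c ∧ a^i_j), χ_j⟩` for all `i` and `c`, and
`σ₀[f] = ⋁_i ⋁_n n · σ₀⟨‖f(i) = n‖, χ_i⟩` for all `f`, all the suprema being required to
exist. -/
def IsGivenBy {X Y I J : Type*} [TopologicalSpace X] [TopologicalSpace Y]
    (σ : BaireAA X I → BaireAA Y J) (D : EmbData X Y I J) (h : BaireAA Y J) : Prop :=
  ∃ σ₀ : BaireAA X I → BaireAA Y J,
    (∀ x, σ x = σ₀ x + h) ∧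
    (∀ (i : I) (c : Cat X),
      IsLUB (Set.range fun j : J =>
          iprod (D.τ i j ⟨c ⊓ D.a i j, Set.mem_Iic.2 inf_le_right⟩ : Cat Y) (chi j))
        (σ₀ (iprod c (chi i)))) ∧
    (∀ x : BaireAA X I, ∃ u : I → BaireAA Y J,
      (∀ i, IsLUB (Set.range fun n : ℕ => n • σ₀ (iprod (boolVal x i n) (chi i))) (u i)) ∧
      IsLUB (Set.range u) (σ₀ x))

end BaireQuot

open BaireQuot

/-!
The category algebra `Cat(X)` is complete for every space `X`: by the Banach category theorem
(`isMeagre_of_locally_isMeagre`) the union of open representatives represents the supremum.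
An element `x` of `Baire(X, ℕ^I)/=_aa` is the same thing as a family of sequences
`lev x i k = ‖x(i) > k‖` in `Cat(X)` which, for each `i`, decrease to `⊥`; order and lattice
operations are computed levelwise (`BaireAA.le_iff_lev`, `BaireAA.exists_lev_eq`).

An order embedding with convex range preserves all existing suprema and infima of nonempty sets,
since bounds can be moved into the range; this gives the lattice homomorphism and dual continuity.
Subtracting the least value `σ(0)` leaves an embedding `g` onto a lower set. The interval below
`⟨⊤, χ_i⟩` is Boolean, and an element below which all elements have complements is
`{0, 1}`-valued, so `g⟨⊤, χ_i⟩` is given by elements `b^i_j` of `Cat(Y)`; pulling back the pieces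
`⟨b^i_j, χ_j⟩` gives the partitions `a^i_j` and the isomorphisms `τ^i_j`
(`BaireAA.exists_embData`). The formula for general `x` needs `g(n • u) = n • g(u)` for
`u = ⟨c, χ_i⟩` (`BaireAA.map_nsmul_iprod_chi`). Here `≤` holds because `[n • u, (n + 1) • u]` is a
complemented interval and `(n + 1) • u` has the same support as `u`, both of which are visible in
the order. If `≥` failed on a piece `⟨d, χ_j⟩ = g(v)`, then `g((n + 1) • v) ≤ g(n • v)`, whence
`v = 0`.

Conversely, given the data, `(c_i)_i ↦ (⋁_i τ^i_j (c_i ∧ a^i_j))_j` applied to each level defines an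
embedding onto a lower set (`EmbData.exists_embedding`). It satisfies the supremum formula because
every embedding onto a lower set does, and that formula also yields uniqueness.
-/

namespace BaireQuot

universe u v w

/-! ### The Banach category theorem and completeness of the category algebra -/

theorem isNowhereDense_biUnion_inter {X : Type u} [TopologicalSpace X] {𝒱 : Set (Set X)}
    (ho : ∀ V ∈ 𝒱, IsOpen V) (hd : 𝒱.PairwiseDisjoint id) {N : Set X → Set X}
    (hN : ∀ V ∈ 𝒱, IsNowhereDense (N V)) : IsNowhereDense (⋃ V ∈ 𝒱, V ∩ N V) := by
  rw [isNowhereDense_iff_forall_notMem_nhds]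
  intro x hx hcl
  simp only [Set.mem_iUnion] at hx
  obtain ⟨V, hV, hxV, hxN⟩ := hx
  refine isNowhereDense_iff_forall_notMem_nhds.1 (hN V hV) x hxN ?_
  filter_upwards [hcl, (ho V hV).mem_nhds hxV] with y hy hyV
  have hy' := (ho V hV).inter_closure ⟨hyV, hy⟩
  refine closure_mono ?_ hy'
  rintro z ⟨hzV, hz⟩
  simp only [Set.mem_iUnion] at hz
  obtain ⟨W, hW, hzW, hzN⟩ := hz
  rwa [hd.elim_set hV hW z hzV hzW]

/-- The disjoint case of the Banach category theorem: the `n`-th nowhere dense pieces chosen inside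
the members of a disjoint family of open sets unite to a nowhere dense set. -/
theorem isMeagre_of_pairwiseDisjoint {X : Type u} [TopologicalSpace X] {𝒱 : Set (Set X)}
    (ho : ∀ V ∈ 𝒱, IsOpen V) (hd : 𝒱.PairwiseDisjoint id) {B : Set X}
    (hm : ∀ V ∈ 𝒱, IsMeagre (V ∩ B)) : IsMeagre (⋃₀ 𝒱 ∩ B) := by
  have key : ∀ V : Set X, ∃ N : ℕ → Set X, V ∈ 𝒱 →
      (∀ n, IsNowhereDense (N n)) ∧ V ∩ B ⊆ ⋃ n, N n := by
    intro V
    by_cases hV : V ∈ 𝒱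
    · obtain ⟨S, hS, hc, hsub⟩ := isMeagre_iff_countable_union_isNowhereDense.1 (hm V hV)
      obtain ⟨N, hN⟩ := (hc.insert ∅).exists_eq_range (Set.insert_nonempty _ _)
      refine ⟨N, fun _ => ⟨fun n => ?_, ?_⟩⟩
      · have : N n ∈ insert ∅ S := hN ▸ Set.mem_range_self n
        rcases this with h | h
        · rw [h]; exact isNowhereDense_empty
        · exact hS _ h
      · rw [← Set.sUnion_range, ← hN]
        exact hsub.trans (Set.sUnion_mono (Set.subset_insert _ _))
    · exact ⟨fun _ => ∅, fun h => (hV h).elim⟩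
  choose N hN using key
  refine (isMeagre_iUnion fun n : ℕ => (isNowhereDense_biUnion_inter ho hd (N := fun V => N V n)
    fun V hV => (hN V hV).1 n).isMeagre).mono ?_
  rintro x ⟨⟨V, hV, hxV⟩, hxB⟩
  obtain ⟨n, hn⟩ := Set.mem_iUnion.1 ((hN V hV).2 ⟨hxV, hxB⟩)
  simp only [Set.mem_iUnion]
  exact ⟨n, V, hV, hxV, hn⟩

/-- The Banach category theorem: a set which is locally meager is meager. No countability of
the cover and no Baire space is needed. -/
theorem isMeagre_of_locally_isMeagre {X : Type u} [TopologicalSpace X] {𝒰 : Set (Set X)}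
    (ho : ∀ U ∈ 𝒰, IsOpen U) {B : Set X} (hm : ∀ U ∈ 𝒰, IsMeagre (U ∩ B))
    (hB : B ⊆ ⋃₀ 𝒰) : IsMeagre B := by
  obtain ⟨𝒱, h𝒱⟩ := zorn_subset
    {𝒱 : Set (Set X) | (∀ V ∈ 𝒱, IsOpen V ∧ IsMeagre (V ∩ B)) ∧ 𝒱.PairwiseDisjoint id} (by
      intro c hc hchain
      refine ⟨⋃₀ c, ⟨?_, ?_⟩, fun s hs => Set.subset_sUnion_of_mem hs⟩
      · rintro V ⟨s, hs, hV⟩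
        exact (hc hs).1 V hV
      · exact (Set.pairwiseDisjoint_sUnion hchain.directedOn).2 fun s hs => (hc hs).2)
  have hmax := h𝒱.prop
  have h1 : IsMeagre (⋃₀ 𝒱 ∩ B) :=
    isMeagre_of_pairwiseDisjoint (fun V hV => (hmax.1 V hV).1) hmax.2 fun V hV => (hmax.1 V hV).2
  have hoV : IsOpen (⋃₀ 𝒱) := isOpen_sUnion fun V hV => (hmax.1 V hV).1
  -- By maximality, no nonempty open subset of a member of `𝒰` misses `⋃₀ 𝒱`.
  have h2 : IsNowhereDense (⋃₀ 𝒰 \ ⋃₀ 𝒱) := by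
    rw [isNowhereDense_iff_forall_notMem_nhds]
    rintro x ⟨⟨U, hU, hxU⟩, hxV⟩ hcl
    obtain ⟨O, hO, hOo, hxO⟩ := mem_nhds_iff.1 hcl
    have hOV : Disjoint O (⋃₀ 𝒱) := by
      refine Set.disjoint_left.2 fun y hy hyV => ?_
      have : closure (⋃₀ 𝒰 \ ⋃₀ 𝒱) ⊆ (⋃₀ 𝒱)ᶜ :=
        closure_minimal (fun z hz => hz.2) hoV.isClosed_compl
      exact this (hO hy) hyV
    have hin : insert (O ∩ U) 𝒱 ⊆ 𝒱 := by
      refine h𝒱.le_of_ge ⟨?_, ?_⟩ (Set.subset_insert _ _)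
      · rintro V (rfl | hV)
        · exact ⟨hOo.inter (ho U hU),
            (hm U hU).mono (Set.inter_subset_inter_left _ Set.inter_subset_right)⟩
        · exact hmax.1 V hV
      · refine hmax.2.insert fun V hV _ => ?_
        exact hOV.mono Set.inter_subset_left (Set.subset_sUnion_of_mem hV)
    exact hxV ⟨O ∩ U, hin (Set.mem_insert _ _), hxO, hxU⟩
  refine (h1.union h2.isMeagre).mono fun x hx => ?_
  by_cases hxV : x ∈ ⋃₀ 𝒱
  · exact Or.inl ⟨hxV, hx⟩
  · exact Or.inr ⟨hB hx, hxV⟩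

namespace Cat

variable {X : Type u} [TopologicalSpace X]

theorem mk_le_mk {s t : Set X} {hs : BaireMeasurableSet s} {ht : BaireMeasurableSet t} :
    mk s hs ≤ mk t ht ↔ ∀ᶠ z in residual X, z ∈ s → z ∈ t := Iff.rfl

theorem exists_mk (a : Cat X) : ∃ s, ∃ hs : BaireMeasurableSet s, a = mk s hs := by
  induction a using Quotient.inductionOn with
  | h s => exact ⟨s.1, s.2, rfl⟩

theorem exists_isOpen_mk (a : Cat X) : ∃ U, ∃ hU : IsOpen U, a = mk U hU.baireMeasurableSet := by
  obtain ⟨s, hs, rfl⟩ := exists_mk a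
  obtain ⟨U, hU, h⟩ := hs.residualEq_isOpen
  refine ⟨U, hU, Quotient.sound ?_⟩
  filter_upwards [h] with z hz using iff_of_eq hz

/-- The supremum of a family of classes is the class of the union of open representatives. -/
theorem exists_isLUB (S : Set (Cat X)) : ∃ a, IsLUB S a := by
  let 𝒰 : Set (Set X) := {U | ∃ hU : IsOpen U, mk U hU.baireMeasurableSet ∈ S}
  have ho : IsOpen (⋃₀ 𝒰) := isOpen_sUnion fun U hU => hU.1
  refine ⟨mk (⋃₀ 𝒰) ho.baireMeasurableSet, ?_, ?_⟩
  · intro a ha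
    obtain ⟨U, hU, rfl⟩ := exists_isOpen_mk a
    exact mk_le_mk.2 (.of_forall fun z hz => ⟨U, ⟨hU, ha⟩, hz⟩)
  · intro a ha
    obtain ⟨t, ht, rfl⟩ := exists_mk a
    have : IsMeagre (⋃₀ 𝒰 \ t) := by
      refine isMeagre_of_locally_isMeagre (𝒰 := 𝒰) (fun U hU => hU.1) (fun U hU => ?_)
        Set.sdiff_subset
      have hle := mk_le_mk.1 (ha hU.2)
      refine mem_of_superset hle ?_
      rintro z hz ⟨hzU, -, hzt⟩
      exact hzt (hz hzU)
    refine mk_le_mk.2 (mem_of_superset this ?_)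
    intro z hz hzU
    by_contra hzt
    exact hz ⟨hzU, hzt⟩

noncomputable instance : CompleteBooleanAlgebra (Cat X) where
  __ := (inferInstance : BooleanAlgebra (Cat X))
  sSup S := (exists_isLUB S).choose
  isLUB_sSup S := (exists_isLUB S).choose_spec
  sInf S := (exists_isLUB (lowerBounds S)).choose
  isGLB_sInf S := isLUB_lowerBounds.1 (exists_isLUB (lowerBounds S)).choose_spec

end Cat

/-! ### Levels of Baire functions -/

theorem baireMeasurableSet_lt {X : Type u} [TopologicalSpace X] {g : X → ℕ}
    (hg : BaireMeasurable g) (k : ℕ) : BaireMeasurableSet {z | k < g z} :=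
  hg (Set.Ioi k) (isOpen_discrete _)

namespace BaireAA

variable {X : Type u} [TopologicalSpace X] {I : Type w}

/-- The `k`-th level `[{z | k < f z i}] ∈ Cat(X)` of the `i`-th coordinate. For fixed `i` the
levels decrease to `⊥`, and they determine the coordinate. -/
def lev (x : BaireAA X I) (i : I) (k : ℕ) : Cat X :=
  Quotient.lift
    (fun f : BaireFun X I => Cat.mk {z | k < f.1 z i} (baireMeasurableSet_lt (f.2 i) k))
    (fun f g h => Quotient.sound <| by
      filter_upwards [h i] with z hz
      simp only [hz]) x

theorem exists_mk (x : BaireAA X I) : ∃ f, ∃ hf : ∀ i, BaireMeasurable fun z => f z i,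
    x = mk f hf := by
  induction x using Quotient.inductionOn with
  | h f => exact ⟨f.1, f.2, rfl⟩

theorem le_iff_lev {x y : BaireAA X I} : x ≤ y ↔ ∀ i k, lev x i k ≤ lev y i k := by
  obtain ⟨f, hf, rfl⟩ := exists_mk x
  obtain ⟨g, hg, rfl⟩ := exists_mk y
  refine forall_congr' fun i => ⟨fun h k => ?_, fun h => ?_⟩
  · refine Cat.mk_le_mk.2 ?_
    filter_upwards [h] with z hz hk using lt_of_lt_of_le hk hz
  · filter_upwards [eventually_countable_forall.2 fun k => Cat.mk_le_mk.1 (h k)] with z hz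
    by_contra hlt
    exact lt_irrefl _ (hz (g z i) (not_le.1 hlt))

theorem lev_mono {x y : BaireAA X I} (h : x ≤ y) (i : I) (k : ℕ) : lev x i k ≤ lev y i k :=
  le_iff_lev.1 h i k

theorem ext_lev {x y : BaireAA X I} (h : ∀ i k, lev x i k = lev y i k) : x = y :=
  le_antisymm (le_iff_lev.2 fun i k => (h i k).le) (le_iff_lev.2 fun i k => (h i k).ge)

theorem lev_sup (x y : BaireAA X I) (i : I) (k : ℕ) :
    lev (x ⊔ y) i k = lev x i k ⊔ lev y i k := by
  obtain ⟨f, hf, rfl⟩ := exists_mk x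
  obtain ⟨g, hg, rfl⟩ := exists_mk y
  exact Quotient.sound (.of_forall fun z =>
    show k < max (f z i) (g z i) ↔ k < f z i ∨ k < g z i from lt_max_iff)

theorem lev_inf (x y : BaireAA X I) (i : I) (k : ℕ) :
    lev (x ⊓ y) i k = lev x i k ⊓ lev y i k := by
  obtain ⟨f, hf, rfl⟩ := exists_mk x
  obtain ⟨g, hg, rfl⟩ := exists_mk y
  exact Quotient.sound (.of_forall fun z =>
    show k < min (f z i) (g z i) ↔ k < f z i ∧ k < g z i from lt_min_iff)

theorem lev_antitone (x : BaireAA X I) (i : I) : Antitone (lev x i) := by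
  obtain ⟨f, hf, rfl⟩ := exists_mk x
  exact fun k l h => Cat.mk_le_mk.2 (.of_forall fun z hz => lt_of_le_of_lt h hz)

theorem iInf_lev (x : BaireAA X I) (i : I) : ⨅ k, lev x i k = ⊥ := by
  obtain ⟨f, hf, rfl⟩ := exists_mk x
  refine le_bot_iff.1 ?_
  obtain ⟨s, hs, h⟩ := Cat.exists_mk (⨅ k, lev (mk f hf) i k)
  rw [h]
  have : ∀ k, ∀ᶠ z in residual X, z ∈ s → k < f z i := fun k =>
    Cat.mk_le_mk.1 (h ▸ iInf_le (fun k => lev (mk f hf) i k) k)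
  refine Cat.mk_le_mk.2 ?_
  filter_upwards [eventually_countable_forall.2 this] with z hz hzs
  exact lt_irrefl _ (hz (f z i) hzs)

open scoped Classical in
/-- A decreasing sequence in the category algebra with infimum `⊥` is the sequence of levels of
some Baire function into `ℕ`. -/
theorem exists_levels {d : ℕ → Cat X} (hd : Antitone d) (hb : ⨅ k, d k = ⊥) :
    ∃ (g : X → ℕ) (hg : BaireMeasurable g), ∀ k,
      Cat.mk {z | k < g z} (baireMeasurableSet_lt hg k) = d k := by
  choose D hD hdD using fun k => Cat.exists_mk (d k)
  let g : X → ℕ := fun z => if h : ∃ k, z ∉ D k then Nat.find h else 0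
  have hlt : ∀ k, {z | k < g z} = (⋂ l : Set.Iic k, D l) \ ⋂ l, D l := by
    intro k
    ext z
    by_cases h : ∃ k, z ∉ D k
    · have hg : g z = Nat.find h := dif_pos h
      have h' : z ∉ ⋂ l, D l := by simpa using h
      simp only [Set.mem_ofPred_eq, hg, Nat.lt_find_iff, not_not, Set.mem_sdiff, h',
        not_false_eq_true, and_true, Set.mem_iInter, Subtype.forall, Set.mem_Iic]
    · have hg : g z = 0 := dif_neg h
      have h' : z ∈ ⋂ l, D l := by simpa using h
      simp [hg, h']
  have hmeas : ∀ k, BaireMeasurableSet {z | k < g z} := fun k => by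
    rw [hlt]
    exact (BaireMeasurableSet.iInter fun l : Set.Iic k => hD l).diff (BaireMeasurableSet.iInter hD)
  have hg : BaireMeasurable g := baireMeasurable_nat_iff.2 fun n => by
    cases n with
    | zero =>
      convert (hmeas 0).compl using 1
      ext z; simp
    | succ n =>
      convert (hmeas n).diff (hmeas (n + 1)) using 1
      ext z
      simp only [Set.mem_ofPred_eq, Set.mem_sdiff]
      omega
  refine ⟨g, hg, fun k => ?_⟩
  have hall : ∀ᶠ z in residual X, z ∉ ⋂ l, D l := by
    have : Cat.mk (⋂ l, D l) (BaireMeasurableSet.iInter hD) ≤ ⊥ := hb ▸ le_iInf fun k => by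
      rw [hdD k]
      exact Cat.mk_le_mk.2 (.of_forall fun z hz => Set.mem_iInter.1 hz k)
    exact Cat.mk_le_mk.1 this
  have hanti : ∀ᶠ z in residual X, ∀ l m, l ≤ m → z ∈ D m → z ∈ D l := by
    refine eventually_countable_forall.2 fun l => eventually_countable_forall.2 fun m => ?_
    by_cases hlm : l ≤ m
    · have := hd hlm
      rw [hdD l, hdD m] at this
      filter_upwards [Cat.mk_le_mk.1 this] with z hz _ using hz
    · exact .of_forall fun z h => (hlm h).elim
  rw [hdD k]
  refine Quotient.sound ?_
  filter_upwards [hall, hanti] with z h1 h2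
  change z ∈ {z | k < g z} ↔ z ∈ D k
  rw [hlt]
  constructor
  · intro h
    exact Set.mem_iInter.1 h.1 ⟨k, Set.mem_Iic.2 le_rfl⟩
  · intro h
    exact ⟨Set.mem_iInter.2 fun l => h2 l k l.2 h, h1⟩

theorem exists_lev_eq {d : I → ℕ → Cat X} (hd : ∀ i, Antitone (d i))
    (hb : ∀ i, ⨅ k, d i k = ⊥) : ∃ x : BaireAA X I, ∀ i k, lev x i k = d i k := by
  choose g hg h using fun i => exists_levels (hd i) (hb i)
  exact ⟨mk (fun z i => g i z) hg, h⟩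

theorem lev_zero (i : I) (k : ℕ) : lev (0 : BaireAA X I) i k = ⊥ :=
  Quotient.sound (.of_forall fun _ => iff_of_false (Nat.not_lt_zero _) id)

theorem zero_le (x : BaireAA X I) : 0 ≤ x :=
  le_iff_lev.2 fun i k => by rw [lev_zero]; exact bot_le

theorem nsmul_mk (n : ℕ) {f : X → I → ℕ} (hf : ∀ i, BaireMeasurable fun z => f z i) :
    ∃ hf', n • mk f hf = mk (fun z i => n * f z i) hf' := by
  induction n with
  | zero => exact ⟨fun i => (hf i).map₂ (hf i) fun a _ => 0 * a, by
      rw [zero_nsmul]; exact Quotient.sound fun i => .of_forall fun _ => (zero_mul _).symm⟩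
  | succ n ih =>
    obtain ⟨hf', h⟩ := ih
    refine ⟨fun i => (hf i).map₂ (hf i) fun a _ => (n + 1) * a, ?_⟩
    rw [succ_nsmul, h]
    exact Quotient.sound fun i => .of_forall fun _ => (Nat.succ_mul _ _).symm

/-- A multiple of a `{0, 1}`-valued function. -/
theorem lev_nsmul {x : BaireAA X I} {i : I} (hx : lev x i 1 = ⊥) (n k : ℕ) :
    lev (n • x) i k = if k < n then lev x i 0 else ⊥ := by
  obtain ⟨f, hf, rfl⟩ := exists_mk x
  obtain ⟨hf', h⟩ := nsmul_mk n hf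
  rw [h]
  have h1 : ∀ᶠ z in residual X, ¬ 1 < f z i := Cat.mk_le_mk.1 hx.le
  split_ifs with hk
  · refine Quotient.sound ?_
    filter_upwards [h1] with z hz
    obtain h0 | h0 : f z i = 0 ∨ f z i = 1 := by omega
    · simp [h0]
    · simp [h0, hk]
  · refine Quotient.sound ?_
    filter_upwards [h1] with z hz
    refine iff_of_false ?_ id
    obtain h0 | h0 : f z i = 0 ∨ f z i = 1 := by omega
    · simp [h0]
    · simpa [h0] using hk

open scoped Classical in
theorem lev_iprod_chi (c : Cat X) (i j : I) (k : ℕ) :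
    lev (iprod c (chi i)) j k = if j = i ∧ k = 0 then c else ⊥ := by
  obtain ⟨s, hs, rfl⟩ := Cat.exists_mk c
  split_ifs with h
  · obtain ⟨rfl, rfl⟩ := h
    refine Quotient.sound (.of_forall fun z => ?_)
    change 0 < (if z ∈ s then chi j else 0) j ↔ z ∈ s
    by_cases hz : z ∈ s <;> simp [hz, chi]
  · refine Quotient.sound (.of_forall fun z => ?_)
    refine iff_of_false ?_ id
    change ¬ k < (if z ∈ s then chi i else 0) j
    by_cases hz : z ∈ s
    · by_cases hj : j = i
      · subst hj
        simp only [hz, if_true, chi, Pi.single_eq_same]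
        simp only [true_and] at h
        omega
      · simp [hz, chi, hj]
    · simp [hz]

open scoped Classical in
theorem lev_nsmul_iprod_chi (n : ℕ) (c : Cat X) (i j : I) (k : ℕ) :
    lev (n • iprod c (chi i)) j k = if j = i ∧ k < n then c else ⊥ := by
  rw [lev_nsmul (by simp [lev_iprod_chi])]
  by_cases hj : j = i <;> simp [lev_iprod_chi, hj]

theorem nsmul_iprod_chi_le_iff {n : ℕ} {c : Cat X} {i : I} {x : BaireAA X I} :
    n • iprod c (chi i) ≤ x ↔ ∀ k < n, c ≤ lev x i k := by
  classical
  rw [le_iff_lev]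
  constructor
  · intro h k hk
    simpa [lev_nsmul_iprod_chi, hk] using h i k
  · intro h j k
    rw [lev_nsmul_iprod_chi]
    split_ifs with hjk
    · obtain ⟨rfl, hk⟩ := hjk
      exact h k hk
    · exact bot_le

theorem succ_nsmul_iprod_chi_le_iff {n : ℕ} {c : Cat X} {i : I} {x : BaireAA X I} :
    (n + 1) • iprod c (chi i) ≤ x ↔ c ≤ lev x i n := by
  rw [nsmul_iprod_chi_le_iff]
  exact ⟨fun h => h n n.lt_succ_self,
    fun h k hk => h.trans (lev_antitone x i (Nat.le_of_lt_succ hk))⟩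

theorem iprod_chi_le_iff {c : Cat X} {i : I} {x : BaireAA X I} :
    iprod c (chi i) ≤ x ↔ c ≤ lev x i 0 := by
  simpa using succ_nsmul_iprod_chi_le_iff (n := 0) (c := c) (i := i) (x := x)

theorem iprod_chi_le_iprod_chi {c d : Cat X} {i : I} :
    iprod c (chi i) ≤ iprod d (chi i) ↔ c ≤ d := by
  classical
  rw [iprod_chi_le_iff, lev_iprod_chi, if_pos ⟨rfl, rfl⟩]

theorem iprod_bot_chi (i : I) : iprod (⊥ : Cat X) (chi i) = 0 := by
  classical
  exact ext_lev fun j k => by rw [lev_iprod_chi, lev_zero, ite_self]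

theorem iprod_chi_inf (c d : Cat X) (i : I) :
    iprod (c ⊓ d) (chi i) = iprod c (chi i) ⊓ iprod d (chi i) := by
  classical
  refine ext_lev fun j k => ?_
  simp only [lev_inf, lev_iprod_chi]
  split_ifs <;> simp

theorem iprod_chi_inf_of_ne (c d : Cat X) {i j : I} (h : i ≠ j) :
    iprod c (chi i) ⊓ iprod d (chi j) = 0 := by
  classical
  refine ext_lev fun l k => ?_
  simp only [lev_inf, lev_iprod_chi, lev_zero]
  split_ifs with h1 h2
  · exact (h (h1.1.symm.trans h2.1)).elim
  all_goals simp

theorem exists_eq_iprod_chi {x : BaireAA X I} {c : Cat X} {i : I} (h : x ≤ iprod c (chi i)) :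
    x = iprod (lev x i 0) (chi i) := by
  classical
  refine le_antisymm (le_iff_lev.2 fun j k => ?_) (iprod_chi_le_iff.2 le_rfl)
  have := lev_mono h j k
  rw [lev_iprod_chi] at this ⊢
  split_ifs at this ⊢ with hjk
  · obtain ⟨rfl, rfl⟩ := hjk
    exact le_rfl
  · exact this

/-! ### Sums and canonical suprema -/

theorem add_le_add_iff {x y h : BaireAA X I} : x + h ≤ y + h ↔ x ≤ y := by
  obtain ⟨f, hf, rfl⟩ := exists_mk x
  obtain ⟨g, hg, rfl⟩ := exists_mk y
  obtain ⟨p, hp, rfl⟩ := exists_mk h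
  refine forall_congr' fun i => eventually_congr (.of_forall fun z => ?_)
  exact Nat.add_le_add_iff_right

theorem exists_eq_add_of_le {h y : BaireAA X I} (hy : h ≤ y) : ∃ x, y = x + h := by
  obtain ⟨g, hg, rfl⟩ := exists_mk y
  obtain ⟨p, hp, rfl⟩ := exists_mk h
  refine ⟨mk (fun z i => g z i - p z i) fun i => (hg i).map₂ (hp i) (· - ·), ?_⟩
  refine Quotient.sound fun i => ?_
  filter_upwards [hy i] with z hz using (Nat.sub_add_cancel hz).symm

theorem le_add_left' (x h : BaireAA X I) : h ≤ x + h := by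
  simpa using add_le_add_iff (h := h).2 (zero_le x)

theorem lev_le_of_boolVal_le {x y : BaireAA X I} {i : I}
    (h : ∀ n, ∀ k < n, boolVal x i n ≤ lev y i k) (k : ℕ) : lev x i k ≤ lev y i k := by
  obtain ⟨f, hf, rfl⟩ := exists_mk x
  obtain ⟨g, hg, rfl⟩ := exists_mk y
  have h' : ∀ n, ∀ᶠ z in residual X, k < n → f z i = n → k < g z i := fun n => by
    by_cases hk : k < n
    · have := Cat.mk_le_mk.1 (h n k hk)
      filter_upwards [this] with z hz _ using hz
    · exact .of_forall fun z hz => (hk hz).elim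
  refine Cat.mk_le_mk.2 ?_
  filter_upwards [eventually_countable_forall.2 h'] with z hz hk using hz _ hk rfl

theorem boolVal_le_lev (x : BaireAA X I) (i : I) {n k : ℕ} (hk : k < n) :
    boolVal x i n ≤ lev x i k := by
  obtain ⟨f, hf, rfl⟩ := exists_mk x
  refine Cat.mk_le_mk.2 (.of_forall fun z hz => ?_)
  exact lt_of_lt_of_eq hk (Eq.symm hz)

/-- Every element is the supremum of its coordinates, and each coordinate is the supremum of the
multiples `n • ⟨‖x(i) = n‖, χ_i⟩`. -/
theorem exists_isLUB_boolVal (x : BaireAA X I) : ∃ u : I → BaireAA X I,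
    (∀ i, IsLUB (Set.range fun n : ℕ => n • iprod (boolVal x i n) (chi i)) (u i)) ∧
      IsLUB (Set.range u) x := by
  classical
  have key : ∀ i, ∃ u : BaireAA X I, ∀ j k, lev u j k = if j = i then lev x i k else ⊥ := fun i =>
    exists_lev_eq
      (fun j k l hkl => by
        split_ifs
        · exact lev_antitone x i hkl
        · exact le_rfl)
      (fun j => by
        split_ifs
        · exact iInf_lev x i
        · simp)
  choose u hu using key
  refine ⟨u, fun i => ⟨?_, ?_⟩, ?_, ?_⟩
  · rintro _ ⟨n, rfl⟩
    refine nsmul_iprod_chi_le_iff.2 fun k hk => ?_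
    rw [hu, if_pos rfl]
    exact boolVal_le_lev x i hk
  · intro y hy
    refine le_iff_lev.2 fun j k => ?_
    rw [hu]
    split_ifs with hj
    · subst hj
      exact lev_le_of_boolVal_le (fun n => nsmul_iprod_chi_le_iff.1 (hy ⟨n, rfl⟩)) k
    · exact bot_le
  · rintro _ ⟨i, rfl⟩
    refine le_iff_lev.2 fun j k => ?_
    rw [hu]
    split_ifs with hj
    · rw [hj]
    · exact bot_le
  · intro y hy
    refine le_iff_lev.2 fun i k => ?_
    have := lev_mono (hy ⟨i, rfl⟩) i k
    rwa [hu, if_pos rfl] at this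

end BaireAA

/-! ### Order embeddings with convex range -/

section Convex

variable {P : Type u} {Q : Type v} [Lattice P] [Lattice Q]

/-- An upper bound `w` of `f '' S` can be replaced by `w ⊓ f z`, which lies between values of `f`
and hence is itself a value. -/
theorem isLUB_image_of_ordConnected (f : P ↪o Q) (hf : (Set.range f).OrdConnected) {S : Set P}
    (hS : S.Nonempty) {z : P} (hz : IsLUB S z) : IsLUB (f '' S) (f z) := by
  refine ⟨f.monotone.mem_upperBounds_image hz.1, fun w hw => ?_⟩
  obtain ⟨s, hs⟩ := hS
  obtain ⟨t, ht⟩ := hf.out (Set.mem_range_self s) (Set.mem_range_self z)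
    (⟨le_inf (hw ⟨s, hs, rfl⟩) (f.monotone (hz.1 hs)), inf_le_right⟩ : w ⊓ f z ∈ Set.Icc _ _)
  have : z ≤ t := hz.2 fun r hr => f.le_iff_le.1 <| by
    rw [ht]
    exact le_inf (hw ⟨r, hr, rfl⟩) (f.monotone (hz.1 hr))
  exact (f.monotone this).trans (ht.trans_le inf_le_left)

theorem map_sup_of_ordConnected (f : P ↪o Q) (hf : (Set.range f).OrdConnected) (x y : P) :
    f (x ⊔ y) = f x ⊔ f y := by
  have := isLUB_image_of_ordConnected f hf (Set.insert_nonempty x {y}) isLUB_pair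
  rw [Set.image_pair] at this
  exact this.unique isLUB_pair

theorem ordConnected_range_dual (f : P ↪o Q) (hf : (Set.range f).OrdConnected) :
    (Set.range f.dual).OrdConnected :=
  Set.OrdConnected.dual hf

theorem map_inf_of_ordConnected (f : P ↪o Q) (hf : (Set.range f).OrdConnected) (x y : P) :
    f (x ⊓ y) = f x ⊓ f y :=
  map_sup_of_ordConnected f.dual (ordConnected_range_dual f hf) (OrderDual.toDual x)
    (OrderDual.toDual y)

theorem isLatticeHom_of_ordConnected (f : P ↪o Q) (hf : (Set.range f).OrdConnected) :
    IsLatticeHom f :=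
  fun x y => ⟨map_sup_of_ordConnected f hf x y, map_inf_of_ordConnected f hf x y⟩

theorem continuous_scott_of_ordConnected (f : P ↪o Q) (hf : (Set.range f).OrdConnected) :
    @Continuous P Q (Topology.scott P Set.univ) (Topology.scott Q Set.univ) f := by
  let _ : TopologicalSpace P := Topology.scott P Set.univ
  let _ : TopologicalSpace Q := Topology.scott Q Set.univ
  have : Topology.IsScott P Set.univ := ⟨rfl⟩
  have : Topology.IsScott Q Set.univ := ⟨rfl⟩
  refine (Topology.IsScott.scottContinuousOn_iff_continuous (D := Set.univ)
    fun _ _ _ => trivial).1 ?_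
  exact fun S _ hS _ a ha => isLUB_image_of_ordConnected f hf hS ha

theorem duallyContinuous_of_ordConnected (f : P ↪o Q) (hf : (Set.range f).OrdConnected) :
    DuallyContinuous f :=
  ⟨continuous_scott_of_ordConnected f hf,
    continuous_scott_of_ordConnected f.dual (ordConnected_range_dual f hf)⟩

end Convex

namespace BaireAA

variable {X : Type*} {Y : Type*} {I : Type*} {J : Type*}
  [TopologicalSpace X] [TopologicalSpace Y]

/-! ### Order embeddings onto lower sets -/

/-- If every element of the interval `[v, w]` has a complement in that interval, then
`w ≤ v + 1`. -/
theorem lev_succ_le_of_complemented {v w : BaireAA X I}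
    (hvw : v ≤ w) (h : ∀ t, v ≤ t → t ≤ w → ∃ s, t ⊓ s = v ∧ t ⊔ s = w) (i : I) (m : ℕ) :
    lev w i (m + 1) ≤ lev v i m := by
  classical
  rw [← sdiff_eq_bot_iff]
  set d := lev w i (m + 1) \ lev v i m
  have hdv : d ⊓ lev v i m = ⊥ := by rw [inf_comm, inf_sdiff_self_right]
  have hdw : d ≤ lev w i (m + 1) := sdiff_le
  -- On `d`, `v ≤ m` and `m + 2 ≤ w`; the element `t` takes the value `m + 1` there.
  obtain ⟨s, h1, h2⟩ := h (v ⊔ (m + 1) • iprod d (chi i)) le_sup_left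
    (sup_le hvw (succ_nsmul_iprod_chi_le_iff.2 (hdw.trans (lev_antitone w i m.le_succ))))
  have hs : d ≤ lev s i m := by
    have h3 : d ≤ lev v i (m + 1) ⊔ lev s i (m + 1) := by
      refine hdw.trans_eq ?_
      rw [← h2, lev_sup, lev_sup, lev_nsmul_iprod_chi, if_neg (by omega), sup_bot_eq]
    calc d ≤ d ⊓ (lev v i m ⊔ lev s i m) :=
          le_inf le_rfl (h3.trans (sup_le_sup (lev_antitone v i m.le_succ)
            (lev_antitone s i m.le_succ)))
      _ = d ⊓ lev s i m := by rw [inf_sup_left, hdv, bot_sup_eq]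
      _ ≤ lev s i m := inf_le_right
  have ht : d ≤ lev v i m := by
    rw [← h1, lev_inf]
    refine le_inf ?_ hs
    rw [lev_sup, lev_nsmul_iprod_chi, if_pos ⟨rfl, m.lt_succ_self⟩]
    exact le_sup_right
  exact le_bot_iff.1 ((le_inf le_rfl ht).trans hdv.le)

/-- Intervals `[n • u, (n + 1) • u]` with `u = ⟨c, χ_i⟩` are complemented. -/
theorem exists_compl_nsmul_iprod_chi {n : ℕ} {c : Cat X} {i : I} {t : BaireAA X I}
    (h1 : n • iprod c (chi i) ≤ t) (h2 : t ≤ (n + 1) • iprod c (chi i)) :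
    ∃ s, t ⊓ s = n • iprod c (chi i) ∧ t ⊔ s = (n + 1) • iprod c (chi i) := by
  classical
  have ht : ∀ j k, lev t j k ≤ if j = i ∧ k < n + 1 then c else ⊥ := fun j k => by
    rw [← lev_nsmul_iprod_chi]; exact lev_mono h2 j k
  have ht' : ∀ k < n, lev t i k = c := fun k hk => le_antisymm
    ((ht i k).trans_eq (if_pos ⟨rfl, by omega⟩)) (nsmul_iprod_chi_le_iff.1 h1 k hk)
  refine ⟨n • iprod c (chi i) ⊔ (n + 1) • iprod (c \ lev t i n) (chi i), ?_, ?_⟩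
  all_goals
    refine ext_lev fun j k => ?_
    have hjk := ht j k
    simp only [lev_inf, lev_sup, lev_nsmul_iprod_chi]
    by_cases hj : j = i
    · subst hj
      rcases lt_trichotomy k n with hk | rfl | hk
      · simp [ht' k hk, hk, hk.trans n.lt_succ_self]
      · simp only [true_and, Nat.lt_succ_self, if_true] at hjk
        simp [hjk]
      · have : ¬ k < n + 1 := by omega
        simp only [this, and_false, if_false, le_bot_iff] at hjk
        simp [hjk, this, not_lt_of_gt hk]
    · simp only [hj, false_and, if_false, le_bot_iff] at hjk ⊢
      simp [hjk]

section Lower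

variable (g : BaireAA X I ↪o BaireAA Y J) (hg : IsLowerSet (Set.range g))
include hg

theorem exists_map_eq_of_le {x : BaireAA X I} {y : BaireAA Y J} (h : y ≤ g x) :
    ∃ t ≤ x, g t = y := by
  obtain ⟨t, ht⟩ := hg h ⟨x, rfl⟩
  exact ⟨t, g.le_iff_le.1 (ht.trans_le h), ht⟩

theorem map_zero_of_isLowerSet : g 0 = 0 := by
  obtain ⟨t, -, ht⟩ := exists_map_eq_of_le g hg (zero_le (g 0))
  exact le_antisymm ((g.monotone (zero_le t)).trans_eq ht) (zero_le _)

theorem map_inf_of_isLowerSet (x y : BaireAA X I) : g (x ⊓ y) = g x ⊓ g y :=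
  map_inf_of_ordConnected g hg.ordConnected x y

theorem isLUB_image_of_isLowerSet {S : Set (BaireAA X I)} {z : BaireAA X I} (hz : IsLUB S z) :
    IsLUB (g '' S) (g z) := by
  rcases S.eq_empty_or_nonempty with rfl | hS
  · have : z = 0 := le_antisymm (hz.2 (by simp)) (zero_le z)
    rw [this, map_zero_of_isLowerSet g hg, Set.image_empty]
    exact ⟨by simp, fun y _ => zero_le y⟩
  · exact isLUB_image_of_ordConnected g hg.ordConnected hS hz

/-- The interval `[g (n • u), g ((n + 1) • u)]` with `u = ⟨c, χ_i⟩` is complemented, because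
`[n • u, (n + 1) • u]` is; hence `g ((n + 1) • u) ≤ g (n • u) + 1`. -/
theorem lev_succ_map_le (n : ℕ) (c : Cat X) (i : I) (j : J) (m : ℕ) :
    lev (g ((n + 1) • iprod c (chi i))) j (m + 1) ≤ lev (g (n • iprod c (chi i))) j m := by
  have hle : n • iprod c (chi i) ≤ (n + 1) • iprod c (chi i) := by
    rw [succ_nsmul']; exact le_add_left' _ _
  refine lev_succ_le_of_complemented (g.monotone hle) (fun t h1 h2 => ?_) j m
  obtain ⟨t, -, rfl⟩ := exists_map_eq_of_le g hg h2
  obtain ⟨s, hs1, hs2⟩ := exists_compl_nsmul_iprod_chi (g.le_iff_le.1 h1) (g.le_iff_le.1 h2)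
  exact ⟨g s, by rw [← map_inf_of_isLowerSet g hg, hs1],
    by rw [← map_sup_of_ordConnected g hg.ordConnected, hs2]⟩

theorem lev_map_iprod_chi_one (c : Cat X) (i : I) (j : J) :
    lev (g (iprod c (chi i))) j 1 = ⊥ := by
  have := lev_succ_map_le g hg 0 c i j 0
  rw [zero_nsmul, map_zero_of_isLowerSet g hg, lev_zero, zero_add, one_nsmul] at this
  exact le_bot_iff.1 this

/-- The support of an element is determined by the elements disjoint from it, so embeddings onto
lower sets respect inclusion of supports. -/
theorem lev_map_zero_le {u w : BaireAA X I} (h : ∀ i, lev w i 0 ≤ lev u i 0) (j : J) :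
    lev (g w) j 0 ≤ lev (g u) j 0 := by
  classical
  rw [← sdiff_eq_bot_iff]
  set d := lev (g w) j 0 \ lev (g u) j 0
  obtain ⟨t, htw, ht⟩ := exists_map_eq_of_le g hg (iprod_chi_le_iff.2 (sdiff_le : d ≤ _))
  have h1 : g (t ⊓ u) = 0 := by
    rw [map_inf_of_isLowerSet g hg, ht]
    refine ext_lev fun l k => ?_
    rw [lev_inf, lev_iprod_chi, lev_zero]
    split_ifs with hl
    · obtain ⟨rfl, rfl⟩ := hl
      rw [inf_comm, inf_sdiff_self_right]
    · simp
  have h2 : t ⊓ u = 0 := g.injective (h1.trans (map_zero_of_isLowerSet g hg).symm)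
  have h3 : t = 0 := by
    refine le_antisymm (le_iff_lev.2 fun i k => ?_) (zero_le t)
    have h4 : lev (t ⊓ u) i 0 = ⊥ := by rw [h2, lev_zero]
    rw [lev_inf] at h4
    calc lev t i k ≤ lev t i 0 := lev_antitone t i (Nat.zero_le k)
      _ ≤ lev t i 0 ⊓ lev u i 0 := le_inf le_rfl ((lev_mono htw i 0).trans (h i))
      _ = lev 0 i k := by rw [h4, lev_zero]
  rw [h3, map_zero_of_isLowerSet g hg] at ht
  have : lev (iprod d (chi j)) j 0 = ⊥ := by rw [← ht, lev_zero]
  simpa [lev_iprod_chi] using this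

/-- Embeddings onto lower sets commute with multiples of `⟨c, χ_i⟩`. -/
theorem map_nsmul_iprod_chi (n : ℕ) : ∀ (i : I) (c : Cat X),
    g (n • iprod c (chi i)) = n • g (iprod c (chi i)) := by
  classical
  induction n with
  | zero => intro i c; rw [zero_nsmul, zero_nsmul, map_zero_of_isLowerSet g hg]
  | succ n ih =>
    have hle : ∀ (i : I) (c : Cat X),
        g ((n + 1) • iprod c (chi i)) ≤ (n + 1) • g (iprod c (chi i)) := by
      intro i c
      refine le_iff_lev.2 fun j k => ?_
      rw [lev_nsmul (lev_map_iprod_chi_one g hg c i j)]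
      split_ifs with hk
      · refine (lev_antitone _ j (Nat.zero_le k)).trans (lev_map_zero_le g hg (fun l => ?_) j)
        rw [lev_nsmul_iprod_chi, lev_iprod_chi]
        simp
      · obtain ⟨m, rfl⟩ : ∃ m, k = m + 1 := ⟨k - 1, by omega⟩
        refine (lev_succ_map_le g hg n c i j m).trans ?_
        rw [ih, lev_nsmul (lev_map_iprod_chi_one g hg c i j), if_neg (by omega)]
    intro i c
    refine le_antisymm (hle i c) (le_iff_lev.2 fun j k => ?_)
    rw [lev_nsmul (lev_map_iprod_chi_one g hg c i j)]
    split_ifs with hk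
    swap
    · exact bot_le
    refine le_trans ?_ (lev_antitone _ j (Nat.le_of_lt_succ hk))
    rw [← sdiff_eq_bot_iff]
    set d := lev (g (iprod c (chi i))) j 0 \ lev (g ((n + 1) • iprod c (chi i))) j n
    -- `⟨d, χ_j⟩` is the value of some `v = ⟨e, χ_i⟩`, and `g ((n + 1) • v) ≤ g (n • v)`.
    obtain ⟨v, hv, hgv⟩ := exists_map_eq_of_le g hg (iprod_chi_le_iff.2 (sdiff_le : d ≤ _))
    obtain ⟨e, rfl⟩ : ∃ e, v = iprod e (chi i) := ⟨_, exists_eq_iprod_chi hv⟩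
    have hec : e ≤ c := iprod_chi_le_iprod_chi.1 hv
    have h1 : g ((n + 1) • iprod e (chi i)) ≤ g (n • iprod e (chi i)) := by
      refine le_iff_lev.2 fun l k => ?_
      have h2 := lev_mono (hle i e) l k
      rw [hgv, lev_nsmul_iprod_chi] at h2
      rw [ih, hgv, lev_nsmul_iprod_chi]
      by_cases hlk : l = j ∧ k = n
      · obtain ⟨rfl, rfl⟩ := hlk
        rw [if_pos ⟨rfl, k.lt_succ_self⟩] at h2
        have h3 : lev (g ((k + 1) • iprod e (chi i))) l k ≤
            lev (g ((k + 1) • iprod c (chi i))) l k :=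
          lev_mono (g.monotone (succ_nsmul_iprod_chi_le_iff.2 (by
            rw [lev_nsmul_iprod_chi, if_pos ⟨rfl, k.lt_succ_self⟩]; exact hec))) l k
        refine (le_inf h2 h3).trans ?_
        rw [inf_comm, inf_sdiff_self_right]
        exact bot_le
      · refine h2.trans_eq (if_congr ?_ rfl rfl)
        constructor
        · rintro ⟨rfl, h⟩
          have : k ≠ n := fun h => hlk ⟨rfl, h⟩
          exact ⟨rfl, by omega⟩
        · exact fun h => ⟨h.1, h.2.trans n.lt_succ_self⟩
    have h4 := succ_nsmul_iprod_chi_le_iff.1 (g.le_iff_le.1 h1)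
    rw [lev_nsmul_iprod_chi, if_neg (by simp), le_bot_iff] at h4
    rw [h4, iprod_bot_chi, map_zero_of_isLowerSet g hg] at hgv
    have : lev (iprod d (chi j)) j 0 = ⊥ := by rw [← hgv, lev_zero]
    simpa [lev_iprod_chi] using this

/-- Embeddings onto lower sets preserve suprema and the multiples of `⟨c, χ_i⟩`, so they carry
the canonical representation of `x` as a supremum to one of `g x`. -/
theorem exists_isLUB_map_boolVal (x : BaireAA X I) : ∃ u : I → BaireAA Y J,
    (∀ i, IsLUB (Set.range fun n : ℕ => n • g (iprod (boolVal x i n) (chi i))) (u i)) ∧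
      IsLUB (Set.range u) (g x) := by
  obtain ⟨u, h1, h2⟩ := exists_isLUB_boolVal x
  refine ⟨fun i => g (u i), fun i => ?_, ?_⟩
  · have := isLUB_image_of_isLowerSet g hg (h1 i)
    rw [← Set.range_comp] at this
    convert this using 3 with n
    exact (map_nsmul_iprod_chi g hg n i _).symm
  · have := isLUB_image_of_isLowerSet g hg h2
    rwa [← Set.range_comp] at this

end Lower

/-- The supremum formula determines a map from its values on the elements `⟨c, χ_i⟩`. -/
theorem eq_of_isLUB_boolVal {f g : BaireAA X I → BaireAA Y J}
    (hf : ∀ x, ∃ u : I → BaireAA Y J,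
      (∀ i, IsLUB (Set.range fun n : ℕ => n • f (iprod (boolVal x i n) (chi i))) (u i)) ∧
        IsLUB (Set.range u) (f x))
    (hg : ∀ x, ∃ u : I → BaireAA Y J,
      (∀ i, IsLUB (Set.range fun n : ℕ => n • g (iprod (boolVal x i n) (chi i))) (u i)) ∧
        IsLUB (Set.range u) (g x))
    (h : ∀ (i : I) (c : Cat X), f (iprod c (chi i)) = g (iprod c (chi i))) : f = g := by
  funext x
  obtain ⟨u, hu, hux⟩ := hf x
  obtain ⟨v, hv, hvx⟩ := hg x
  have : u = v := funext fun i => by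
    have := hu i
    simp only [h] at this
    exact this.unique (hv i)
  rw [this] at hux
  exact hux.unique hvx

/-- An order embedding with convex range is an embedding onto a lower set followed by the
translation by its least value. -/
theorem exists_eq_add_of_ordConnected (σ : BaireAA X I ↪o BaireAA Y J)
    (hσ : (Set.range σ).OrdConnected) :
    ∃ g : BaireAA X I ↪o BaireAA Y J, IsLowerSet (Set.range g) ∧ ∀ x, σ x = g x + σ 0 := by
  choose g hg using fun x => exists_eq_add_of_le (σ.monotone (zero_le x))
  have hmap : ∀ x y, g x ≤ g y ↔ x ≤ y := fun x y => by
    rw [← add_le_add_iff (h := σ 0), ← hg, ← hg, σ.le_iff_le]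
  refine ⟨OrderEmbedding.ofMapLEIff g hmap, ?_, hg⟩
  rintro _ y hy ⟨x, rfl⟩
  have hy' : y + σ 0 ≤ σ x := by rw [hg x]; exact add_le_add_iff.2 hy
  obtain ⟨t, ht⟩ := hσ.out ⟨0, rfl⟩ ⟨x, rfl⟩ ⟨le_add_left' y (σ 0), hy'⟩
  rw [hg t] at ht
  exact ⟨t, le_antisymm (add_le_add_iff.1 ht.le) (add_le_add_iff.1 ht.ge)⟩

/-- Every embedding onto a lower set is described by partitions and isomorphisms: the interval
below `⟨⊤, χ_i⟩` is a copy of `Cat(X)` and its image is a product of principal ideals of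
`Cat(Y)`. -/
theorem exists_embData (g : BaireAA X I ↪o BaireAA Y J) (hg : IsLowerSet (Set.range g)) :
    ∃ D : EmbData X Y I J, ∀ (i : I) (c : Cat X),
      IsLUB (Set.range fun j : J =>
          iprod (D.τ i j ⟨c ⊓ D.a i j, Set.mem_Iic.2 inf_le_right⟩ : Cat Y) (chi j))
        (g (iprod c (chi i))) := by
  classical
  let b : I → J → Cat Y := fun i j => lev (g (iprod ⊤ (chi i))) j 0
  have ha : ∀ i j, ∃ a : Cat X, g (iprod a (chi i)) = iprod (b i j) (chi j) := fun i j => by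
    obtain ⟨v, hv, hgv⟩ := exists_map_eq_of_le g hg (iprod_chi_le_iff.2 (le_refl (b i j)))
    rw [exists_eq_iprod_chi hv] at hgv
    exact ⟨_, hgv⟩
  choose a ha using ha
  have hlev : ∀ i j (c : Cat X), c ≤ a i j →
      g (iprod c (chi i)) = iprod (lev (g (iprod c (chi i))) j 0) (chi j) := fun i j c hc =>
    exists_eq_iprod_chi (c := b i j) ((g.monotone (iprod_chi_le_iprod_chi.2 hc)).trans_eq (ha i j))
  have hτ : ∀ i j, ∃ τ : Set.Iic (a i j) ≃o Set.Iic (b i j),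
      ∀ c, (τ c : Cat Y) = lev (g (iprod (c : Cat X) (chi i))) j 0 := fun i j => by
    let e : Set.Iic (a i j) ↪o Set.Iic (b i j) := OrderEmbedding.ofMapLEIff
      (fun c => ⟨lev (g (iprod (c : Cat X) (chi i))) j 0,
        lev_mono (g.monotone (iprod_chi_le_iprod_chi.2 le_top)) j 0⟩) fun c d => by
        rw [← Subtype.coe_le_coe, ← Subtype.coe_le_coe,
          ← iprod_chi_le_iprod_chi (i := j), ← hlev i j c c.2, ← hlev i j d d.2, g.le_iff_le,
          iprod_chi_le_iprod_chi]
    have he : Function.Surjective e := by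
      rintro ⟨d, hd⟩
      have hd' : iprod d (chi j) ≤ g (iprod (a i j) (chi i)) := by
        rw [ha]; exact iprod_chi_le_iprod_chi.2 hd
      obtain ⟨v, hv, hgv⟩ := exists_map_eq_of_le g hg hd'
      have hv' := exists_eq_iprod_chi hv
      refine ⟨⟨lev v i 0, iprod_chi_le_iprod_chi.1 (hv'.symm.trans_le hv)⟩, Subtype.ext ?_⟩
      change lev (g (iprod (lev v i 0) (chi i))) j 0 = d
      rw [← hv', hgv, lev_iprod_chi, if_pos ⟨rfl, rfl⟩]
    exact ⟨RelIso.ofSurjective e he, fun c => rfl⟩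
  choose τ hτ using hτ
  have hbot : ∀ (i : I) (c : Cat X), g (iprod c (chi i)) = 0 → c = ⊥ := fun i c h => by
    have h' := g.injective (h.trans (map_zero_of_isLowerSet g hg).symm)
    rw [← iprod_bot_chi i] at h'
    exact le_bot_iff.1 (iprod_chi_le_iprod_chi.1 h'.le)
  -- Values on `⟨c, χ_i⟩` are `{0, 1}`-valued, hence compared at level `0`.
  have hle : ∀ (i : I) (c : Cat X) (y : BaireAA Y J),
      (∀ j, lev (g (iprod c (chi i))) j 0 ≤ lev y j 0) → g (iprod c (chi i)) ≤ y := by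
    intro i c y h
    refine le_iff_lev.2 fun j k => ?_
    cases k with
    | zero => exact h j
    | succ k =>
      refine (lev_antitone _ j (by omega : 1 ≤ k + 1)).trans ?_
      rw [lev_map_iprod_chi_one g hg]
      exact bot_le
  refine ⟨⟨a, b, τ, ?_, ?_, ?_⟩, ?_⟩
  · intro i j j' hj
    refine hbot i _ ?_
    rw [iprod_chi_inf, map_inf_of_isLowerSet g hg, ha, ha, iprod_chi_inf_of_ne _ _ hj]
  · refine fun i => ⟨fun _ _ => le_top, fun e he => ?_⟩
    refine iprod_chi_le_iprod_chi.1 (g.le_iff_le.1 (hle i ⊤ _ fun j => ?_))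
    refine iprod_chi_le_iff.1 (?_ : iprod (b i j) (chi j) ≤ _)
    rw [← ha]
    exact g.monotone (iprod_chi_le_iprod_chi.2 (he ⟨j, rfl⟩))
  · intro i i' j hi
    change lev _ j 0 ⊓ lev _ j 0 = ⊥
    rw [← lev_inf, ← map_inf_of_isLowerSet g hg, iprod_chi_inf_of_ne _ _ hi,
      map_zero_of_isLowerSet g hg, lev_zero]
  · intro i c
    refine ⟨?_, fun z hz => hle i c z fun j => ?_⟩
    · rintro _ ⟨j, rfl⟩
      simp only [hτ]
      rw [← hlev i j _ inf_le_right]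
      exact g.monotone (iprod_chi_le_iprod_chi.2 inf_le_left)
    · refine le_trans ?_ (iprod_chi_le_iff.1 (hz ⟨j, rfl⟩))
      simp only [hτ]
      rw [iprod_chi_inf, map_inf_of_isLowerSet g hg, lev_inf, ha, lev_iprod_chi,
        if_pos ⟨rfl, rfl⟩]
      exact le_inf le_rfl (lev_mono (g.monotone (iprod_chi_le_iprod_chi.2 le_top)) j 0)

end BaireAA

/-! ### Embeddings from partitions and isomorphisms -/

section Restrict

variable {A : Type u} {B : Type v} [Lattice A] [Lattice B] {a : A} {b : B}

/-- An isomorphism between principal ideals, extended to the whole lattice by first meeting with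
the generator. -/
def restrict (τ : Set.Iic a ≃o Set.Iic b) (c : A) : B := τ ⟨c ⊓ a, Set.mem_Iic.2 inf_le_right⟩

theorem restrict_le (τ : Set.Iic a ≃o Set.Iic b) (c : A) : restrict τ c ≤ b := (τ _).2

theorem restrict_mono (τ : Set.Iic a ≃o Set.Iic b) : Monotone (restrict τ) :=
  fun _ _ h => τ.monotone (Subtype.mk_le_mk.2 (inf_le_inf_right a h))

theorem restrict_symm_restrict (τ : Set.Iic a ≃o Set.Iic b) (c : A) :
    restrict τ.symm (restrict τ c) = c ⊓ a := by
  have : (⟨restrict τ c ⊓ b, Set.mem_Iic.2 inf_le_right⟩ : Set.Iic b) =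
      τ ⟨c ⊓ a, Set.mem_Iic.2 inf_le_right⟩ :=
    Subtype.ext (inf_eq_left.2 (restrict_le τ c))
  rw [restrict, this, OrderIso.symm_apply_apply]

theorem restrict_restrict_symm (τ : Set.Iic a ≃o Set.Iic b) (d : B) :
    restrict τ (restrict τ.symm d) = d ⊓ b :=
  restrict_symm_restrict τ.symm d

theorem restrict_bot [OrderBot A] [OrderBot B] (τ : Set.Iic a ≃o Set.Iic b) :
    restrict τ ⊥ = ⊥ :=
  le_bot_iff.1 <| (restrict_mono τ bot_le).trans <|
    (restrict_restrict_symm τ ⊥).trans_le inf_le_left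

end Restrict

namespace EmbData

open BaireAA

variable {X : Type*} {Y : Type*} {I : Type*} {J : Type*}
  [TopologicalSpace X] [TopologicalSpace Y] (D : EmbData X Y I J)

/-- As the `b i j` are disjoint in `i`, each summand can be recovered from the supremum. -/
theorem iSup_restrict_inf (d : I → Cat X) (i : I) (j : J) :
    (⨆ i', restrict (D.τ i' j) (d i')) ⊓ D.b i j = restrict (D.τ i j) (d i) := by
  rw [iSup_inf_eq]
  refine le_antisymm (iSup_le fun i' => ?_)
    (le_iSup_of_le i (le_inf le_rfl (restrict_le _ _)))
  by_cases h : i' = i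
  · subst h
    exact inf_le_left
  · refine (inf_le_inf_right _ (restrict_le _ _)).trans ?_
    rw [D.disjoint_b _ _ _ h]
    exact bot_le

/-- Passing to all the suprema `⋁_i τ^i_j (c_i ∧ a^i_j)` loses no information on `(c_i)_i`: the
pieces `c_i ∧ a^i_j` are recovered, and the `a i j` cover for each `i`. -/
theorem iSup_restrict_le_iff {d e : I → Cat X} :
    (∀ j, ⨆ i, restrict (D.τ i j) (d i) ≤ ⨆ i, restrict (D.τ i j) (e i)) ↔ ∀ i, d i ≤ e i := by
  refine ⟨fun h i => ?_, fun h j => iSup_mono fun i => restrict_mono _ (h i)⟩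
  have key : ∀ j, D.a i j ≤ (d i)ᶜ ⊔ e i := fun j => by
    have h1 := inf_le_inf_right (D.b i j) (h j)
    rw [iSup_restrict_inf, iSup_restrict_inf] at h1
    have h2 := restrict_mono (D.τ i j).symm h1
    rw [restrict_symm_restrict, restrict_symm_restrict] at h2
    rw [sup_comm, ← himp_eq, le_himp_iff, inf_comm]
    exact h2.trans inf_le_left
  have h3 : ⊤ ≤ (d i)ᶜ ⊔ e i := (D.sup_a i).2 (by rintro _ ⟨j, rfl⟩; exact key j)
  rw [sup_comm, ← himp_eq, le_himp_iff, top_inf_eq] at h3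
  exact h3

theorem exists_lev_eq_iSup (x : BaireAA X I) : ∃ y : BaireAA Y J, ∀ j k,
    lev y j k = ⨆ i, restrict (D.τ i j) (lev x i k) := by
  refine exists_lev_eq (d := fun j k => ⨆ i, restrict (D.τ i j) (lev x i k))
    (fun j k l h => iSup_mono fun i => restrict_mono _ (lev_antitone x i h)) fun j => ?_
  -- The infimum meets each `b i j` in `⊥`, and lies below their supremum.
  set e := ⨅ k, ⨆ i, restrict (D.τ i j) (lev x i k)
  have hek : ∀ k, e ≤ ⨆ i, restrict (D.τ i j) (lev x i k) := fun k => iInf_le _ k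
  have h1 : ∀ i, e ⊓ D.b i j = ⊥ := fun i => by
    have h2 : restrict (D.τ i j).symm (e ⊓ D.b i j) ≤ ⊥ := by
      rw [← iInf_lev x i]
      refine le_iInf fun k => ?_
      have h3 := restrict_mono (D.τ i j).symm (inf_le_inf_right (D.b i j) (hek k))
      rw [iSup_restrict_inf, restrict_symm_restrict] at h3
      exact h3.trans inf_le_left
    have h4 := restrict_mono (D.τ i j) h2
    rw [restrict_restrict_symm, restrict_bot, inf_assoc, inf_idem] at h4
    exact le_bot_iff.1 h4
  have h2 : e ≤ ⨆ i, D.b i j := (hek 0).trans (iSup_mono fun i => restrict_le _ _)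
  rw [← inf_eq_left.2 h2, inf_iSup_eq]
  simp [h1]

/-- The embedding onto a lower set described by partitions and isomorphisms. On levels it is
`(c_i)_i ↦ (⋁_i τ^i_j (c_i ∧ a^i_j))_j`. -/
theorem exists_embedding : ∃ g : BaireAA X I ↪o BaireAA Y J, IsLowerSet (Set.range g) ∧
    ∀ (i : I) (c : Cat X),
      IsLUB (Set.range fun j : J =>
          iprod (D.τ i j ⟨c ⊓ D.a i j, Set.mem_Iic.2 inf_le_right⟩ : Cat Y) (chi j))
        (g (iprod c (chi i))) := by
  classical
  choose g hg using D.exists_lev_eq_iSup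
  have hle : ∀ x y, g x ≤ g y ↔ x ≤ y := fun x y => by
    rw [le_iff_lev, le_iff_lev]
    simp only [hg]
    rw [forall_comm, forall_congr' fun k => D.iSup_restrict_le_iff (d := fun i => lev x i k)
      (e := fun i => lev y i k), forall_comm]
  refine ⟨OrderEmbedding.ofMapLEIff g hle, ?_, fun i c => ?_⟩
  · rintro _ y hy ⟨x, rfl⟩
    have hyx : ∀ j k, lev y j k ≤ ⨆ i, restrict (D.τ i j) (lev x i k) := fun j k => by
      rw [← hg]; exact lev_mono hy j k
    -- The preimage of `y` has the levels `⋁_j (τ^i_j)⁻¹ (‖y(j) > k‖ ∧ b^i_j)`.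
    have hd : ∀ i k, ⨆ j, restrict (D.τ i j).symm (lev y j k) ≤ lev x i k := fun i k => by
      refine iSup_le fun j => ?_
      have h1 := restrict_mono (D.τ i j).symm (inf_le_inf_right (D.b i j) (hyx j k))
      rw [D.iSup_restrict_inf (fun i => lev x i k), restrict_symm_restrict,
        ← restrict_restrict_symm (D.τ i j), restrict_symm_restrict] at h1
      exact (le_inf le_rfl (restrict_le _ _)).trans (h1.trans inf_le_left)
    obtain ⟨t, ht⟩ := exists_lev_eq (d := fun i k => ⨆ j, restrict (D.τ i j).symm (lev y j k))
      (fun i k l h => iSup_mono fun j => restrict_mono _ (lev_antitone y j h))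
      (fun i => le_bot_iff.1 ((iInf_mono (hd i)).trans_eq (iInf_lev x i)))
    refine ⟨t, ext_lev fun j k => ?_⟩
    change lev (g t) j k = _
    rw [hg]
    have h2 : ∀ i, restrict (D.τ i j) (lev t i k) = lev y j k ⊓ D.b i j := fun i => by
      rw [← restrict_restrict_symm (D.τ i j)]
      have h3 : lev t i k ⊓ D.a i j = restrict (D.τ i j).symm (lev y j k) := by
        rw [ht, iSup_inf_eq]
        refine le_antisymm (iSup_le fun j' => ?_)
          (le_iSup_of_le j (le_inf le_rfl (restrict_le _ _)))
        by_cases h : j' = j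
        · subst h
          exact inf_le_left
        · refine (inf_le_inf_right _ (restrict_le _ _)).trans ?_
          rw [D.disjoint_a _ _ _ h]
          exact bot_le
      rw [← h3, ← restrict_symm_restrict (D.τ i j), restrict_restrict_symm,
        inf_eq_left.2 (restrict_le _ _)]
    simp only [h2]
    rw [← inf_iSup_eq, inf_eq_left]
    exact (hyx j k).trans (iSup_mono fun i => restrict_le _ _)
  · have hlev : ∀ j k, lev (g (iprod c (chi i))) j k =
        if k = 0 then restrict (D.τ i j) c else ⊥ := fun j k => by
      rw [hg]
      refine le_antisymm (iSup_le fun i' => ?_) (le_iSup_of_le i ?_)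
      · rw [lev_iprod_chi]
        by_cases hi : i' = i
        · subst hi
          by_cases hk : k = 0 <;> simp [hk, restrict_bot]
        · simp [hi, restrict_bot]
      · rw [lev_iprod_chi]
        by_cases hk : k = 0 <;> simp [hk]
    refine ⟨?_, fun z hz => le_iff_lev.2 fun j k => ?_⟩
    · rintro _ ⟨j, rfl⟩
      refine iprod_chi_le_iff.2 ?_
      change _ ≤ lev (g _) j 0
      rw [hlev, if_pos rfl]
      exact le_rfl
    · change lev (g _) j k ≤ _
      rw [hlev]
      split_ifs with hk
      · subst hk
        exact iprod_chi_le_iff.1 (hz ⟨j, rfl⟩)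
      · exact bot_le

end EmbData

namespace BaireAA

variable {X : Type*} {Y : Type*} {I : Type*} {J : Type*}
  [TopologicalSpace X] [TopologicalSpace Y]

theorem eq_of_ordConnected_of_eq_iprod_chi [hI : Nonempty I] (ρ σ : BaireAA X I ↪o BaireAA Y J)
    (hρ : (Set.range ρ).OrdConnected) (hσ : (Set.range σ).OrdConnected)
    (h : ∀ (c : Cat X) (i : I), ρ (iprod c (chi i)) = σ (iprod c (chi i))) : ρ = σ := by
  obtain ⟨i⟩ := hI
  have h0 : ρ 0 = σ 0 := by simpa [iprod_bot_chi] using h ⊥ i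
  obtain ⟨f, hf, hfρ⟩ := exists_eq_add_of_ordConnected ρ hρ
  obtain ⟨g, hg, hgσ⟩ := exists_eq_add_of_ordConnected σ hσ
  have hfg : (f : BaireAA X I → BaireAA Y J) = g :=
    eq_of_isLUB_boolVal (exists_isLUB_map_boolVal f hf) (exists_isLUB_map_boolVal g hg)
      fun i c => by
        have hc := h c i
        rw [hfρ, hgσ, h0] at hc
        exact le_antisymm (add_le_add_iff.1 hc.le) (add_le_add_iff.1 hc.ge)
  refine DFunLike.coe_injective (funext fun x => ?_)
  rw [hfρ, hgσ, h0, hfg]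

end BaireAA

theorem IsGivenBy.unique {X Y I J : Type*} [TopologicalSpace X] [TopologicalSpace Y]
    {ρ σ : BaireAA X I → BaireAA Y J} {D : EmbData X Y I J} {h : BaireAA Y J}
    (hρ : IsGivenBy ρ D h) (hσ : IsGivenBy σ D h) : ρ = σ := by
  obtain ⟨f, hf, hf1, hf2⟩ := hρ
  obtain ⟨g, hg, hg1, hg2⟩ := hσ
  have hfg : f = g := BaireAA.eq_of_isLUB_boolVal hf2 hg2 fun i c => (hf1 i c).unique (hg1 i c)
  funext x
  rw [hf, hg, hfg]

/-- The translate by `h` of an embedding onto a lower set has convex range. -/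
theorem exists_translate {X Y I J : Type*} [TopologicalSpace X] [TopologicalSpace Y]
    (g : BaireAA X I ↪o BaireAA Y J) (hg : IsLowerSet (Set.range g)) (h : BaireAA Y J) :
    ∃ σ : BaireAA X I ↪o BaireAA Y J, (Set.range σ).OrdConnected ∧ ∀ x, σ x = g x + h := by
  refine ⟨OrderEmbedding.ofMapLEIff (fun x => g x + h) fun x y => by
    rw [BaireAA.add_le_add_iff, g.le_iff_le], ⟨?_⟩, fun x => rfl⟩
  rintro _ ⟨x, rfl⟩ _ ⟨y, rfl⟩ z ⟨hxz, hzy⟩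
  obtain ⟨w, rfl⟩ := BaireAA.exists_eq_add_of_le ((BaireAA.le_add_left' (g x) h).trans hxz)
  obtain ⟨t, rfl⟩ := hg (BaireAA.add_le_add_iff.1 hzy) ⟨y, rfl⟩
  exact ⟨t, rfl⟩

end BaireQuot

open BaireQuot
theorem mainTheorem7 {X Y I J : Type*} [TopologicalSpace X] [TopologicalSpace Y] :
    (∀ σ : BaireAA X I ↪o BaireAA Y J, (Set.range σ).OrdConnected →
      IsLatticeHom σ ∧
      DuallyContinuous σ ∧
      (Nonempty I → ∀ ρ : BaireAA X I ↪o BaireAA Y J,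
        (Set.range ρ).OrdConnected →
        (∀ (c : Cat X) (i : I),
          ρ (BaireAA.iprod c (BaireAA.chi i)) =
            σ (BaireAA.iprod c (BaireAA.chi i))) →
        ρ = σ) ∧
      ∃ (D : EmbData X Y I J) (h : BaireAA Y J),
        IsGivenBy σ D h) ∧
    (∀ (D : EmbData X Y I J) (h : BaireAA Y J),
      ∃ σ : BaireAA X I ↪o BaireAA Y J,
        (Set.range σ).OrdConnected ∧
        IsGivenBy σ D h ∧
        ∀ ρ : BaireAA X I → BaireAA Y J,
          IsGivenBy ρ D h → ρ = σ) := by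
  constructor
  · intro σ hσ
    refine ⟨isLatticeHom_of_ordConnected σ hσ, duallyContinuous_of_ordConnected σ hσ,
      fun _ ρ hρ h => BaireAA.eq_of_ordConnected_of_eq_iprod_chi ρ σ hρ hσ h, ?_⟩
    obtain ⟨g, hg, hgσ⟩ := BaireAA.exists_eq_add_of_ordConnected σ hσ
    obtain ⟨D, hD⟩ := BaireAA.exists_embData g hg
    exact ⟨D, σ 0, g, hgσ, hD, BaireAA.exists_isLUB_map_boolVal g hg⟩
  · intro D h
    obtain ⟨g, hg, hD⟩ := D.exists_embedding
    obtain ⟨σ, hσ, hgσ⟩ := exists_translate g hg h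
    have hσD : IsGivenBy σ D h := ⟨g, hgσ, hD, BaireAA.exists_isLUB_map_boolVal g hg⟩
    exact ⟨σ, hσ, hσD, fun ρ hρ => hρ.unique hσD⟩
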